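/- **Theorem 1 (Multistability).** Let $G=(\mathcal V,\mathcal E)$ be a finite connected undirected simple graph with $n\ge 1$ nodes and $m$ edges, let $d_i>0$ and $p_i\in\mathbb R$ for $i\in\mathcal V$, let $a_{ij}=a_{ji}>0$ for $\{i,j\}\in\mathcal E$, and consider the Kuramoto model on the torus $\mathbb T^n=(\mathbb R/2\pi\mathbb Z)^n$, $$ d_i\,\dot\theta_i = p_i-\sum_{j:\{i,j\}\in\mathcal E} a_{ij}\sin(\theta_i-\theta_j),\qquad i\in\mathcal V,\ t\ge 0 .$$ Let $\Sigma$ be a cycle basis of $G$, i.e. a set of simple cycles whose cycle vectors (with entries $\pm1$ on the edges traversed positively/negatively and $0$ elsewhere) form a basis of the real span of the cycle vectors of all simple cycles. For a simple cycle $\sigma=(i_1,\dots,i_k,i_{k+1}=i_1)$ let $w_\sigma(\theta)=\frac1{2\pi}\sum_{l=1}^{k} d_{\rm cc}(\theta_{i_l},\theta_{i_{l+1}})$, where $d_{\rm cc}(\alpha,\beta)\in[-\pi,\pi)$ represents $\beta-\alpha$ modulo $2\pi$, put $w_\Sigma=(w_\sigma)_{\sigma\in\Sigma}$, and for $u\in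 w_\Sigma(\mathbb T^n)$ let $\Omega_u=\{\theta\in\mathbb T^n: w_\Sigma(\theta)=u\}$. For $\gamma\in(0,\pi/2)^m$ let $\Delta(\gamma)=\{\theta\in\mathbb T^n: |\theta_i-\theta_j|<\gamma_{ij}\ \forall\{i,j\}\in\mathcal E\}$, where $|\theta_i-\theta_j|$ is the geodesic distance on the circle. A *frequency-synchronized limit cycle* is the orbit $\{\theta(t):t\ge0\}$ of a solution with $\dot\theta_i(t)=\omega$ for all $i\in\mathcal V$ and $t\ge0$, for some constant $\omega\in\mathbb R$ (an equilibrium if $\omega=0$). A *uniform rotation* adds one and the same angle to all components of $\theta$. Then for every $\gamma\in(0,\pi/2)^m$ and every $u\in w_\Sigma(\mathbb T^n)$: 1. Any two frequency-synchronized limit cycles contained in $\Omega_u\cap\Delta(\gamma)$ differ by a uniform rotation, and every such limit cycle is asymptotically stable modulo uniform rotations: the set of all uniform rotations of its points is Lyapunov stable and attracts every trajectory that starts sufficiently near it. 2. Every trajectory $\theta(t)$, $t\ge0$, with $\theta(0)\in\Omega_u\cap\Delta(\gamma)$ either leaves $\Delta(\gamma)$ (that is, $\theta(t)\notin\Delta(\gamma)$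 for some $t\ge0$), or converges exponentially to a frequency-synchronized limit cycle $\Gamma\subseteq\Omega_u\cap\overline{\Delta(\gamma)}$: there are $C\in\mathbb R$ and $\kappa>0$ with $\operatorname{dist}(\theta(t),\Gamma)\le C e^{-\kappa t}$ for all $t\ge 0$. -/

import Mathlib

open scoped Real

noncomputable section

namespace Kuramoto

variable {V : Type*}

/-- The torus `𝕋ⁿ`, one angle in `ℝ / 2πℤ` for each node.  The metric on `Real.Angle` is the geodesic
distance on the circle; the torus carries the corresponding sup metric. -/
abbrev Torus (V : Type*) : Type _ := V → Real.Angle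

/-- The uniform rotation of a state by the angle `c`. -/
def rotate (c : Real.Angle) (θ : Torus V) : Torus V := fun i => θ i + c

/-- The counterclockwise distance from `α` to `β`: the representative of `β - α` in `[-π, π)`
(`Real.Angle.toReal` takes its values in `(-π, π]`). -/
def dcc (α β : Real.Angle) : ℝ := -(α - β).toReal

/-! ### Cycles, winding numbers, winding cells, phase-cohesive sets -/

/-- A simple cycle of `G`, traversed from a base node in one of its two directions. -/
structure SimpleCycle (G : SimpleGraph V) where
  base : V
  walk : G.Walk base base
  isCycle : walk.IsCycle

open Classical in
/-- The cycle vector of `c`: `+1` on an oriented edge that is traversed positively, `-1` on one that is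
traversed negatively, `0` otherwise.  It is recorded on both orientations of every edge (as an
antisymmetric function), so that no orientation of `G` has to be chosen. -/
def SimpleCycle.vector {G : SimpleGraph V} (c : SimpleCycle G) : G.Dart → ℝ := fun e =>
  if e ∈ c.walk.darts then 1 else if e.symm ∈ c.walk.darts then -1 else 0

/-- The cycle space: the span of the cycle vectors of all simple cycles. -/
def cycleSpace (G : SimpleGraph V) : Submodule ℝ (G.Dart → ℝ) :=
  Submodule.span ℝ (Set.range fun c : SimpleCycle G => c.vector)

/-- A set of simple cycles whose cycle vectors form a basis of the cycle space. -/
structure IsCycleBasis {G : SimpleGraph V} (S : Set (SimpleCycle G)) : Prop where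
  linearIndependent : LinearIndependent ℝ fun c : S => c.1.vector
  span_eq : Submodule.span ℝ (Set.range fun c : S => c.1.vector) = cycleSpace G

/-- The winding number of `θ` along the cycle `c`. -/
def windingNumber {G : SimpleGraph V} (c : SimpleCycle G) (θ : Torus V) : ℝ :=
  (1 / (2 * π)) * (c.walk.darts.map fun e => dcc (θ e.fst) (θ e.snd)).sum

/-- The winding vector of `θ` along the set of cycles `S`. -/
def windingVector {G : SimpleGraph V} (S : Set (SimpleCycle G)) (θ : Torus V) : S → ℝ :=
  fun c => windingNumber c.1 θ

/-- The `u`-winding cell `Ω_u`. -/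
def windingCell {G : SimpleGraph V} (S : Set (SimpleCycle G)) (u : S → ℝ) : Set (Torus V) :=
  {θ | windingVector S θ = u}

/-- The `γ`-cohesive set `Δ(γ)`; only the values of `γ` on the edges of `G` matter. -/
def cohesiveSet (G : SimpleGraph V) (γ : Sym2 V → ℝ) : Set (Torus V) :=
  {θ | ∀ i j, G.Adj i j → dist (θ i) (θ j) < γ s(i, j)}

/-! ### The heterogeneous Kuramoto model -/

/-- The parameters of a Kuramoto model on `G`: node coefficients `d i > 0`, edge weights `a e > 0`
(only the values on edges matter) and the vector `p`. -/
structure Model (G : SimpleGraph V) where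
  d : V → ℝ
  a : Sym2 V → ℝ
  p : V → ℝ
  d_pos : ∀ i, 0 < d i
  a_pos : ∀ e ∈ G.edgeSet, 0 < a e

variable [Fintype V] {G : SimpleGraph V}

open Classical in
/-- The map `f(θ) = p - B 𝒜 sin(Bᵀ θ)` in coordinates: `f_i = p_i - ∑_j a_ij sin(θ_i - θ_j)`. -/
def Model.f (M : Model G) (θ : Torus V) (i : V) : ℝ :=
  M.p i - ∑ j ∈ Finset.univ.filter (fun j => G.Adj i j), M.a s(i, j) * (θ i - θ j).sin

/-- The nodal frequencies `D⁻¹ f(θ)`. -/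
def Model.freq (M : Model G) (θ : Torus V) (i : V) : ℝ := M.f θ i / M.d i

/-- `θ`, restricted to `t ≥ 0`, is a trajectory of `D θ' = f(θ)`.  The time derivative of a curve on the
torus is the derivative of a lift of the curve to `ℝⁿ`. -/
def Model.IsTrajectory (M : Model G) (θ : ℝ → Torus V) : Prop :=
  ∃ x : ℝ → V → ℝ, (∀ t, 0 ≤ t → ∀ i, θ t i = (x t i : Real.Angle)) ∧
    ∀ t, 0 ≤ t → ∀ i, HasDerivWithinAt (fun s => x s i) (M.freq (θ t) i) (Set.Ici 0) t

/-- `Γ` is a frequency-synchronized limit cycle: the orbit of a trajectory along which all nodal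
frequencies are equal to one constant `ω`.  (If `ω = 0` it is an equilibrium point.) -/
def Model.IsSyncLimitCycle (M : Model G) (Γ : Set (Torus V)) : Prop :=
  ∃ θ : ℝ → Torus V, M.IsTrajectory θ ∧
    (∃ ω : ℝ, ∀ t, 0 ≤ t → ∀ i, M.freq (θ t) i = ω) ∧ Γ = θ '' Set.Ici 0

/-- All uniform rotations of the points of `Γ`. -/
def rotationOrbit (Γ : Set (Torus V)) : Set (Torus V) :=
  {φ | ∃ c : Real.Angle, ∃ θ ∈ Γ, φ = rotate c θ}

/-- `K` is Lyapunov stable for the dynamics and attracts all trajectories that start near it. -/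
def Model.IsAsymptoticallyStable (M : Model G) (K : Set (Torus V)) : Prop :=
  (∀ ε > 0, ∃ δ > 0, ∀ θ : ℝ → Torus V, M.IsTrajectory θ →
    Metric.infDist (θ 0) K < δ → ∀ t, 0 ≤ t → Metric.infDist (θ t) K < ε) ∧
  ∃ δ > 0, ∀ θ : ℝ → Torus V, M.IsTrajectory θ → Metric.infDist (θ 0) K < δ →
    Filter.Tendsto (fun t => Metric.infDist (θ t) K) Filter.atTop (nhds 0)

/-- The distance of `θ t` to `Γ` decays exponentially as `t → ∞`. -/
def ConvergesExponentially (θ : ℝ → Torus V) (Γ : Set (Torus V)) : Prop :=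
  ∃ C κ : ℝ, 0 < κ ∧ ∀ t, 0 ≤ t → Metric.infDist (θ t) Γ ≤ C * Real.exp (-κ * t)

end Kuramoto

end

/-!
# Multistability of synchronous states in winding cells

Inside a cohesive set all phase differences along edges lie in `(-π/2, π/2)`, where the sine is
strongly monotone. Consider two cohesive states whose phase differences, as real numbers, differ by
a gradient `z i - z j`. Summation by parts and a Poincaré inequality on the connected graph show
that the vector field contracts the `d`-weighted norm of the `d`-centred part of `z`, at a uniform
rate (`Model.exists_contraction`). All three claims follow from this estimate.

* Uniqueness. States in the same winding cell have equal winding numbers around a cycle basis.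
  Hence the difference of their phase differences has no circulation around any simple cycle, nor
  around any closed walk, so that it is a gradient (`exists_gradient`). If both states are
  synchronous, the contraction forces this gradient to vanish.
* Stability. A trajectory that starts near a rotation of a synchronous state deviates from the
  rotating solution by a small lifted displacement. The contraction is available as long as the
  energy of the centred displacement is below a threshold, and on the threshold the energy
  decreases; so it is never reached, and the energy decays exponentially
  (`Model.infDist_rotationOrbit_le`).
* Convergence. Along a trajectory that stays cohesive the phase differences follow the lift without
  jumps (`phaseDiff_sub_phaseDiff_zero`). The trajectory and each of its time shifts therefore
  differ by a gradient, and the contraction makes the trajectory, in the frame rotating at the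
  frequency `∑ p / ∑ d`, exponentially Cauchy (`Model.exists_limit_lift`). No existence theorem for
  the differential equation is needed: the limit has constant frequencies, because a convergent
  function whose derivative converges has derivative tending to zero, and its rotations form the
  limit cycle.
-/

open scoped Real

noncomputable section

namespace Kuramoto

open Filter Topology

/-! ### Angles and phase differences -/

theorem norm_angle_eq_abs_toReal (α : Real.Angle) : ‖α‖ = |α.toReal| := by
  have h : ‖((α.toReal : ℝ) : AddCircle (2 * π))‖ = |α.toReal| := by
    rw [AddCircle.norm_coe_eq_abs_iff _ Real.two_pi_pos.ne', abs_of_pos Real.two_pi_pos,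
      mul_div_cancel_left₀ _ two_ne_zero]
    exact α.abs_toReal_le_pi
  have h' : (((α.toReal : ℝ) : AddCircle (2 * π)) : Real.Angle) = α := α.coe_toReal
  rw [← h]
  exact congrArg norm h'.symm

theorem norm_coe_angle_le (x : ℝ) : ‖(x : Real.Angle)‖ ≤ |x| :=
  QuotientAddGroup.norm_mk_le_norm (S := AddSubgroup.zmultiples (2 * π)) (m := x)

theorem toReal_eq_arcsin_sin {α : Real.Angle} (h : |α.toReal| ≤ π / 2) :
    α.toReal = Real.arcsin α.sin := by
  rw [← Real.Angle.sin_toReal, Real.arcsin_sin (abs_le.1 h).1 (abs_le.1 h).2]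

variable {V : Type*} {G : SimpleGraph V}

/-- The phase difference `θ i - θ j`, represented in `(-π, π]`. -/
def phaseDiff (θ : Torus V) (i j : V) : ℝ := (θ i - θ j).toReal

theorem sin_phaseDiff (θ : Torus V) (i j : V) : Real.sin (phaseDiff θ i j) = (θ i - θ j).sin :=
  Real.Angle.sin_toReal _

theorem mem_cohesiveSet_iff {γ : Sym2 V → ℝ} {θ : Torus V} :
    θ ∈ cohesiveSet G γ ↔ ∀ i j, G.Adj i j → |phaseDiff θ i j| < γ s(i, j) := by
  simp only [cohesiveSet, Set.mem_ofPred_eq, dist_eq_norm, norm_angle_eq_abs_toReal, phaseDiff]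

theorem abs_phaseDiff_lt_pi_div_two {γ : Sym2 V → ℝ}
    (hγ : ∀ e ∈ G.edgeSet, γ e ∈ Set.Ioo 0 (π / 2)) {θ : Torus V} (hθ : θ ∈ cohesiveSet G γ)
    (i j : V) (e : G.Adj i j) : |phaseDiff θ i j| < π / 2 :=
  (mem_cohesiveSet_iff.1 hθ i j e).trans (hγ s(i, j) e).2

theorem phaseDiff_swap {θ : Torus V} {i j : V} (h : |phaseDiff θ i j| < π / 2) :
    phaseDiff θ j i = -phaseDiff θ i j := by
  rw [phaseDiff, ← neg_sub, Real.Angle.toReal_neg_eq_neg_toReal_iff.2]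
  · rfl
  · rintro h'
    rw [phaseDiff, h', Real.Angle.toReal_pi, abs_of_pos Real.pi_pos] at h
    linarith [Real.pi_pos]

theorem rotate_sub (c : Real.Angle) (θ : Torus V) (i j : V) :
    rotate c θ i - rotate c θ j = θ i - θ j := add_sub_add_right_eq_sub _ _ _

theorem phaseDiff_rotate (c : Real.Angle) (θ : Torus V) (i j : V) :
    phaseDiff (rotate c θ) i j = phaseDiff θ i j := by
  rw [phaseDiff, rotate_sub, phaseDiff]

theorem rotate_rotate (a b : Real.Angle) (θ : Torus V) :
    rotate a (rotate b θ) = rotate (a + b) θ := by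
  funext i; simp only [rotate]; abel

theorem rotate_mem_cohesiveSet {γ : Sym2 V → ℝ} {θ : Torus V} (c : Real.Angle)
    (h : θ ∈ cohesiveSet G γ) : rotate c θ ∈ cohesiveSet G γ := by
  rw [mem_cohesiveSet_iff] at h ⊢
  simpa only [phaseDiff_rotate] using h

/-- If `θ` is `φ` shifted by the real displacements `z`, up to a uniform rotation, then
`phaseDiff φ i j + (z i - z j)` is the phase difference of `θ` as soon as it lies in `(-π, π)`. -/
theorem phaseDiff_eq_add {θ φ : Torus V} {z : V → ℝ} {c : Real.Angle} {i j : V}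
    (h : ∀ k, θ k = φ k + z k + c) (hlt : |phaseDiff φ i j + (z i - z j)| < π) :
    phaseDiff θ i j = phaseDiff φ i j + (z i - z j) := by
  have h1 : θ i - θ j = ((phaseDiff φ i j + (z i - z j) : ℝ) : Real.Angle) := by
    rw [h i, h j, phaseDiff, Real.Angle.coe_add, Real.Angle.coe_toReal, Real.Angle.coe_sub]
    abel
  rw [abs_lt] at hlt
  rw [phaseDiff, h1, Real.Angle.toReal_coe_eq_self_iff]
  exact ⟨hlt.1, hlt.2.le⟩

/-- Along a cohesive trajectory the phase differences follow the lift without jumps. -/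
theorem phaseDiff_sub_phaseDiff_zero {θ : ℝ → Torus V} {x : ℝ → V → ℝ}
    (hx : ∀ t, 0 ≤ t → ∀ i, θ t i = (x t i : Real.Angle))
    (hcont : ∀ i, ContinuousOn (fun t => x t i) (Set.Ici 0)) {i j : V}
    (hθ : ∀ t, 0 ≤ t → |phaseDiff (θ t) i j| < π / 2) {t : ℝ} (ht : 0 ≤ t) :
    phaseDiff (θ t) i j - phaseDiff (θ 0) i j = x t i - x t j - (x 0 i - x 0 j) := by
  have hpd : ∀ s, 0 ≤ s → phaseDiff (θ s) i j = Real.arcsin (Real.sin (x s i - x s j)) :=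
    fun s hs => by
      have h1 := toReal_eq_arcsin_sin (hθ s hs).le
      rw [hx s hs i, hx s hs j, ← Real.Angle.coe_sub, Real.Angle.sin_coe] at h1
      rwa [phaseDiff, hx s hs i, hx s hs j, ← Real.Angle.coe_sub]
  let f : ℝ → ℝ := fun s => x s i - x s j - Real.arcsin (Real.sin (x s i - x s j))
  have hf : ContinuousOn f (Set.Ici 0) := by
    have h1 := (hcont i).sub (hcont j)
    exact h1.sub ((Real.continuous_arcsin.comp Real.continuous_sin).comp_continuousOn h1)
  have hmaps : Set.MapsTo f (Set.Ici 0) (AddSubgroup.zmultiples (2 * π)) := fun s hs => by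
    have h1 : ((x s i - x s j : ℝ) : Real.Angle) = (phaseDiff (θ s) i j : ℝ) := by
      rw [phaseDiff, Real.Angle.coe_toReal, hx s hs i, hx s hs j, Real.Angle.coe_sub]
    -- Both `x s i - x s j` and the phase difference represent `θ s i - θ s j` modulo `2π`.
    obtain ⟨k, hk⟩ := Real.Angle.angle_eq_iff_two_pi_dvd_sub.1 h1
    refine AddSubgroup.mem_zmultiples_iff.2 ⟨k, ?_⟩
    rw [zsmul_eq_mul, mul_comm, ← hk, hpd s hs]
  have hdisc : IsDiscrete (AddSubgroup.zmultiples (2 * π) : Set ℝ) :=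
    isDiscrete_iff_discreteTopology.2
      (inferInstanceAs (DiscreteTopology (AddSubgroup.zmultiples (2 * π))))
  have h0 : f t = f 0 := isPreconnected_Ici.constant_of_mapsTo hdisc hf hmaps ht
    (Set.mem_Ici.2 le_rfl)
  simp only [f] at h0
  rw [hpd t ht, hpd 0 le_rfl]
  linarith

/-! ### Potentials, circulations and winding numbers -/

/-- A function with equal values at adjacent nodes of a connected graph is constant. -/
theorem eq_of_forall_adj {α : Type*} (hG : G.Connected) {f : V → α}
    (h : ∀ i j, G.Adj i j → f i = f j) (i j : V) : f i = f j := by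
  obtain ⟨w⟩ := hG.preconnected i j
  induction w with
  | nil => rfl
  | cons hadj _ ih => exact (h _ _ hadj).trans ih

/-- The sum of the values of `h` along the darts of a walk. -/
def walkSum (h : V → V → ℝ) {i j : V} (w : G.Walk i j) : ℝ :=
  (w.darts.map fun e => h e.fst e.snd).sum

@[simp] theorem walkSum_nil (h : V → V → ℝ) (i : V) :
    walkSum h (SimpleGraph.Walk.nil : G.Walk i i) = 0 := by simp [walkSum]

@[simp] theorem walkSum_cons (h : V → V → ℝ) {i j k : V} (e : G.Adj i j) (w : G.Walk j k) :
    walkSum h (SimpleGraph.Walk.cons e w) = h i j + walkSum h w := by simp [walkSum]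

theorem walkSum_append (h : V → V → ℝ) {i j k : V} (v : G.Walk i j) (w : G.Walk j k) :
    walkSum h (v.append w) = walkSum h v + walkSum h w := by
  simp [walkSum]

theorem walkSum_reverse {h : V → V → ℝ} (hanti : ∀ i j, G.Adj i j → h j i = -h i j) {i j : V}
    (w : G.Walk i j) : walkSum h w.reverse = -walkSum h w := by
  induction w with
  | nil => simp
  | cons e w ih =>
    rw [SimpleGraph.Walk.reverse_cons, walkSum_append, ih, walkSum_cons, walkSum_cons, walkSum_nil,
      hanti _ _ e]
    ring

open Classical in
/-- If the circulation around every simple cycle vanishes, then removing the loops of a walk does not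
change the sum along it: each removed loop is either a simple cycle or an edge traversed back and
forth. -/
theorem walkSum_bypass {h : V → V → ℝ} (hanti : ∀ i j, G.Adj i j → h j i = -h i j)
    (hcyc : ∀ c : SimpleCycle G, walkSum h c.walk = 0) {i j : V} (w : G.Walk i j) :
    walkSum h w.bypass = walkSum h w := by
  induction w with
  | nil => rfl
  | @cons u v k e w ih =>
    rw [SimpleGraph.Walk.bypass]
    split_ifs with hs
    · have hp : (w.bypass.takeUntil u hs).IsPath := w.bypass_isPath.takeUntil hs
      have hsum : walkSum h w.bypass =
          walkSum h (w.bypass.takeUntil u hs) + walkSum h (w.bypass.dropUntil u hs) := by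
        rw [← walkSum_append, SimpleGraph.Walk.take_spec]
      have hloop : h u v + walkSum h (w.bypass.takeUntil u hs) = 0 := by
        generalize w.bypass.takeUntil u hs = q at hp
        by_cases hq : s(u, v) ∈ q.edges
        · cases q with
          | nil => simp at hq
          | @cons _ b _ e' q' =>
            rw [SimpleGraph.Walk.cons_isPath_iff] at hp
            rw [SimpleGraph.Walk.edges_cons, List.mem_cons] at hq
            rcases hq with hq | hq
            · have hb : b = u := by
                rcases Sym2.eq_iff.1 hq with ⟨h1, _⟩ | ⟨h1, _⟩
                · exact absurd h1 e.ne
                · exact h1.symm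
              subst hb
              have hnil : q' = SimpleGraph.Walk.nil :=
                (SimpleGraph.Walk.isPath_iff_nil.1 hp.1).eq_nil
              rw [hnil, walkSum_cons, walkSum_nil, hanti _ _ e]
              ring
            · exact absurd (q'.snd_mem_support_of_mem_edges hq) hp.2
        · have := hcyc ⟨u, SimpleGraph.Walk.cons e q,
            (SimpleGraph.Walk.cons_isCycle_iff q e).2 ⟨hp, hq⟩⟩
          simpa using this
      rw [walkSum_cons, ← ih, hsum]
      linarith
    · rw [walkSum_cons, walkSum_cons, ih]

open Classical in
/-- A function of the darts without circulation around simple cycles is a gradient. -/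
theorem exists_potential (hG : G.Connected) {h : V → V → ℝ}
    (hanti : ∀ i j, G.Adj i j → h j i = -h i j)
    (hcyc : ∀ c : SimpleCycle G, walkSum h c.walk = 0) :
    ∃ z : V → ℝ, ∀ i j, G.Adj i j → z i - z j = h i j := by
  obtain ⟨r⟩ := hG.nonempty
  let w : ∀ i, G.Walk i r := fun i => (hG.preconnected i r).some
  refine ⟨fun i => walkSum h (w i), fun i j e => ?_⟩
  have hclosed := walkSum_bypass hanti hcyc
    ((SimpleGraph.Walk.cons e (w j)).append (w i).reverse)
  have hnil : ((SimpleGraph.Walk.cons e (w j)).append (w i).reverse).bypass =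
      SimpleGraph.Walk.nil :=
    (SimpleGraph.Walk.isPath_iff_nil.1 (SimpleGraph.Walk.bypass_isPath _)).eq_nil
  rw [hnil, walkSum_nil, walkSum_append, walkSum_cons, walkSum_reverse hanti] at hclosed
  linarith

theorem sum_map_darts_eq_sum_dart [Fintype G.Dart] {h : G.Dart → ℝ} {l : List G.Dart}
    (hl : l.Nodup) [DecidableEq G.Dart] :
    (l.map h).sum = ∑ e, if e ∈ l then h e else 0 := by
  rw [← Finset.sum_filter, ← List.sum_toFinset _ hl]
  refine Finset.sum_congr ?_ fun _ _ => rfl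
  ext e; simp

/-- The circulation of an antisymmetric function around a simple cycle is half its scalar product
with the cycle vector, as every edge carries two darts. -/
theorem sum_vector_mul [Fintype G.Dart] {h : V → V → ℝ}
    (hanti : ∀ i j, G.Adj i j → h j i = -h i j) (c : SimpleCycle G) :
    ∑ e : G.Dart, c.vector e * h e.fst e.snd = 2 * walkSum h c.walk := by
  classical
  have hedges : (c.walk.darts.map SimpleGraph.Dart.edge).Nodup := c.isCycle.edges_nodup
  have hnodup : c.walk.darts.Nodup := hedges.of_map _
  have hsymm : ∀ e, e ∈ c.walk.darts → e.symm ∉ c.walk.darts := fun e he he' =>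
    e.symm_ne (List.inj_on_of_nodup_map hedges he' he e.edge_symm)
  have hsum := sum_map_darts_eq_sum_dart (h := fun e : G.Dart => h e.fst e.snd) hnodup
  have hsum' : walkSum h c.walk =
      ∑ e : G.Dart, if e.symm ∈ c.walk.darts then h e.symm.fst e.symm.snd else 0 := by
    rw [walkSum, hsum]
    exact (Equiv.sum_comp (Function.Involutive.toPerm _ SimpleGraph.Dart.symm_involutive)
      (fun e : G.Dart => if e ∈ c.walk.darts then h e.fst e.snd else 0)).symm
  rw [two_mul]
  nth_rewrite 2 [hsum']
  rw [walkSum, hsum, ← Finset.sum_add_distrib]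
  refine Finset.sum_congr rfl fun e _ => ?_
  have he := hanti _ _ e.adj
  simp only [SimpleCycle.vector]
  by_cases h1 : e ∈ c.walk.darts
  · simp [h1, hsymm e h1]
  · by_cases h2 : e.symm ∈ c.walk.darts
    · simp [h1, h2, he]
    · simp [h1, h2]

/-- An antisymmetric function without circulation around the cycles of a cycle basis has no
circulation around any simple cycle. -/
theorem walkSum_eq_zero_of_basis [Fintype V] {S : Set (SimpleCycle G)} (hS : IsCycleBasis S)
    {h : V → V → ℝ} (hanti : ∀ i j, G.Adj i j → h j i = -h i j)
    (hcyc : ∀ c ∈ S, walkSum h c.walk = 0) (c : SimpleCycle G) : walkSum h c.walk = 0 := by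
  classical
  let L : (G.Dart → ℝ) →ₗ[ℝ] ℝ :=
    ∑ e : G.Dart, h e.fst e.snd • LinearMap.proj (R := ℝ) (φ := fun _ : G.Dart => ℝ) e
  have hL : ∀ c : SimpleCycle G, L c.vector = 2 * walkSum h c.walk := fun c => by
    rw [← sum_vector_mul hanti c]
    simp [L, mul_comm]
  have hle : Submodule.span ℝ (Set.range fun c : S => c.1.vector) ≤ LinearMap.ker L := by
    rw [Submodule.span_le]
    rintro _ ⟨c, rfl⟩
    simp [hL, hcyc c.1 c.2]
  have hc : c.vector ∈ LinearMap.ker L := by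
    apply hle
    rw [hS.span_eq]
    exact Submodule.subset_span ⟨c, rfl⟩
  have := hL c
  rw [LinearMap.mem_ker.1 hc] at this
  linarith

theorem windingNumber_eq (c : SimpleCycle G) (θ : Torus V) :
    windingNumber c θ = -(1 / (2 * π)) * walkSum (phaseDiff θ) c.walk := by
  have : ∀ l : List G.Dart, (l.map fun e => dcc (θ e.fst) (θ e.snd)).sum =
      -(l.map fun e => phaseDiff θ e.fst e.snd).sum := fun l => by
    induction l with
    | nil => simp
    | cons e l ih =>
      rw [List.map_cons, List.sum_cons, ih, List.map_cons, List.sum_cons, neg_add]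
      rfl
  rw [windingNumber, this, walkSum]
  ring

theorem walkSum_sub (g h : V → V → ℝ) {i j : V} (w : G.Walk i j) :
    walkSum (fun i j => g i j - h i j) w = walkSum g w - walkSum h w := by
  induction w with
  | nil => simp
  | cons e w ih => rw [walkSum_cons, walkSum_cons, walkSum_cons, ih]; ring

theorem walkSum_gradient {z : V → ℝ} {h : V → V → ℝ} (hz : ∀ i j, G.Adj i j → h i j = z i - z j)
    {i j : V} (w : G.Walk i j) : walkSum h w = z i - z j := by
  induction w with
  | nil => simp
  | cons e w ih => rw [walkSum_cons, ih, hz _ _ e]; ring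

/-- Phase differences that differ by a gradient have the same winding numbers. -/
theorem windingNumber_eq_of_gradient {θ φ : Torus V} {z : V → ℝ}
    (hz : ∀ i j, G.Adj i j → z i - z j = phaseDiff θ i j - phaseDiff φ i j) (c : SimpleCycle G) :
    windingNumber c θ = windingNumber c φ := by
  have h := walkSum_gradient (h := fun i j => phaseDiff θ i j - phaseDiff φ i j)
    (fun i j e => (hz i j e).symm) c.walk
  rw [walkSum_sub, sub_self, sub_eq_zero] at h
  rw [windingNumber_eq, windingNumber_eq, h]

/-- Two cohesive states in the same winding cell have phase differences that differ by a gradient. -/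
theorem exists_gradient [Fintype V] (hG : G.Connected) {S : Set (SimpleCycle G)}
    (hS : IsCycleBasis S) {u : S → ℝ} {θ φ : Torus V}
    (hθ : θ ∈ windingCell S u) (hφ : φ ∈ windingCell S u)
    (hθ' : ∀ i j, G.Adj i j → |phaseDiff θ i j| < π / 2)
    (hφ' : ∀ i j, G.Adj i j → |phaseDiff φ i j| < π / 2) :
    ∃ z : V → ℝ, ∀ i j, G.Adj i j → z i - z j = phaseDiff θ i j - phaseDiff φ i j := by
  have hanti : ∀ i j, G.Adj i j →
      phaseDiff θ j i - phaseDiff φ j i = -(phaseDiff θ i j - phaseDiff φ i j) := fun i j e => by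
    rw [phaseDiff_swap (hθ' i j e), phaseDiff_swap (hφ' i j e)]
    ring
  refine exists_potential hG hanti (walkSum_eq_zero_of_basis hS hanti fun c hc => ?_)
  have h : windingNumber c θ = windingNumber c φ :=
    (congrFun (hθ : windingVector S θ = u) ⟨c, hc⟩).trans
      (congrFun (hφ : windingVector S φ = u) ⟨c, hc⟩).symm
  rw [windingNumber_eq, windingNumber_eq] at h
  have hpi : -(1 / (2 * π)) ≠ 0 := neg_ne_zero.2 (one_div_pos.2 Real.two_pi_pos).ne'
  rw [walkSum_sub, mul_left_cancel₀ hpi h, sub_self]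

/-! ### The Poincaré inequality on a connected graph -/

theorem abs_sub_le_length_mul {V : Type*} {G : SimpleGraph V} {z : V → ℝ} {r : ℝ}
    (h : ∀ i j, G.Adj i j → |z i - z j| ≤ r)
    {i j : V} (w : G.Walk i j) : |z i - z j| ≤ w.length * r := by
  induction w with
  | nil => simp
  | @cons i k j e w ih =>
    rw [SimpleGraph.Walk.length_cons, Nat.cast_succ]
    linarith [abs_sub_le (z i) (z k) (z j), h _ _ e]

theorem exists_pos_le_of_finite {ι : Type*} [Finite ι] {s : Set ι} {f : ι → ℝ}
    (h : ∀ i ∈ s, 0 < f i) : ∃ c > 0, ∀ i ∈ s, c ≤ f i := by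
  rcases s.eq_empty_or_nonempty with rfl | hs
  · exact ⟨1, one_pos, by simp⟩
  · obtain ⟨i, hi, hmin⟩ := Set.exists_min_image s f s.toFinite hs
    exact ⟨f i, h i hi, hmin⟩

variable {V : Type*} [Fintype V] {G : SimpleGraph V}

open Classical in
/-- The sum of `g i j` over all ordered pairs of adjacent nodes; every edge counts twice. -/
def dartSum (G : SimpleGraph V) (g : V → V → ℝ) : ℝ :=
  ∑ i, ∑ j ∈ Finset.univ.filter (fun j => G.Adj i j), g i j

theorem dartSum_swap (g : V → V → ℝ) : dartSum G (fun i j => g j i) = dartSum G g := by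
  classical
  simp only [dartSum, Finset.sum_filter]
  rw [Finset.sum_comm]
  exact Finset.sum_congr rfl fun i _ => Finset.sum_congr rfl fun j _ =>
    if_congr (G.adj_comm j i) rfl rfl

theorem dartSum_congr {g h : V → V → ℝ} (H : ∀ i j, G.Adj i j → g i j = h i j) :
    dartSum G g = dartSum G h := by
  classical
  exact Finset.sum_congr rfl fun i _ => Finset.sum_congr rfl fun j hj =>
    H i j (Finset.mem_filter.1 hj).2

theorem dartSum_mono {g h : V → V → ℝ} (H : ∀ i j, G.Adj i j → g i j ≤ h i j) :
    dartSum G g ≤ dartSum G h := by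
  classical
  exact Finset.sum_le_sum fun i _ => Finset.sum_le_sum fun j hj => H i j (Finset.mem_filter.1 hj).2

theorem dartSum_add (g h : V → V → ℝ) :
    dartSum G (fun i j => g i j + h i j) = dartSum G g + dartSum G h := by
  simp only [dartSum, Finset.sum_add_distrib]

theorem dartSum_mul_left (c : ℝ) (g : V → V → ℝ) :
    dartSum G (fun i j => c * g i j) = c * dartSum G g := by
  simp only [dartSum, Finset.mul_sum]

theorem le_dartSum {g : V → V → ℝ} (hg : ∀ i j, 0 ≤ g i j) {i j : V} (h : G.Adj i j) :
    g i j ≤ dartSum G g := by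
  classical
  refine le_trans ?_ (Finset.single_le_sum
    (f := fun i => ∑ j ∈ Finset.univ.filter (fun j => G.Adj i j), g i j)
    (fun i _ => Finset.sum_nonneg fun j _ => hg i j) (Finset.mem_univ i))
  exact Finset.single_le_sum (f := fun j => g i j) (fun j _ => hg i j)
    (Finset.mem_filter.2 ⟨Finset.mem_univ j, h⟩)

/-- Poincaré inequality: on a connected graph the variance is bounded by the Dirichlet energy. -/
theorem exists_poincare (hG : G.Connected) {d : V → ℝ} (hd : ∀ i, 0 < d i) :
    ∃ κ > 0, ∀ z : V → ℝ, ∑ i, d i * z i = 0 →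
      κ * ∑ i, d i * z i ^ 2 ≤ dartSum G fun i j => (z i - z j) ^ 2 := by
  obtain ⟨r⟩ := hG.nonempty
  set D := ∑ i, d i with hD
  have hDpos : 0 < D := Finset.sum_pos (fun i _ => hd i) ⟨r, Finset.mem_univ r⟩
  set N : ℝ := ∑ i, ∑ j, (G.dist i j : ℝ) with hN
  have hdist : ∀ i j, (G.dist i j : ℝ) ≤ N := fun i j =>
    (Finset.single_le_sum (f := fun j => (G.dist i j : ℝ)) (fun j _ => Nat.cast_nonneg _)
      (Finset.mem_univ j)).trans
    (Finset.single_le_sum (f := fun i => ∑ j, (G.dist i j : ℝ))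
      (fun i _ => Finset.sum_nonneg fun j _ => Nat.cast_nonneg _) (Finset.mem_univ i))
  have hden : 0 < D * N ^ 2 + 1 := by positivity
  refine ⟨(D * N ^ 2 + 1)⁻¹, inv_pos.2 hden, fun z hz => ?_⟩
  set E := dartSum G fun i j => (z i - z j) ^ 2 with hE
  have hE0 : 0 ≤ E := Finset.sum_nonneg fun i _ => Finset.sum_nonneg fun j _ => sq_nonneg _
  have hedge : ∀ i j, G.Adj i j → |z i - z j| ≤ √E := fun i j e =>
    Real.abs_le_sqrt (le_dartSum (g := fun i j => (z i - z j) ^ 2) (fun _ _ => sq_nonneg _) e)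
  have hpair : ∀ i j, |z i - z j| ≤ N * √E := fun i j => by
    obtain ⟨w, hw⟩ := hG.exists_walk_length_eq_dist i j
    refine (abs_sub_le_length_mul hedge w).trans ?_
    rw [hw]
    exact mul_le_mul_of_nonneg_right (hdist i j) (Real.sqrt_nonneg _)
  have hpoint : ∀ i, z i ^ 2 ≤ N ^ 2 * E := fun i => by
    have h1 : D * z i = ∑ j, d j * (z i - z j) := by
      simp only [mul_sub, Finset.sum_sub_distrib, hz, hD, Finset.sum_mul, sub_zero]
    have h2 : |D * z i| ≤ D * (N * √E) := by
      rw [h1, hD, Finset.sum_mul]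
      refine (Finset.abs_sum_le_sum_abs _ _).trans (Finset.sum_le_sum fun j _ => ?_)
      rw [abs_mul, abs_of_pos (hd j)]
      exact mul_le_mul_of_nonneg_left (hpair i j) (hd j).le
    rw [abs_mul, abs_of_pos hDpos] at h2
    have h3 := le_of_mul_le_mul_left h2 hDpos
    calc z i ^ 2 = |z i| ^ 2 := (sq_abs _).symm
      _ ≤ (N * √E) ^ 2 := pow_le_pow_left₀ (abs_nonneg _) h3 2
      _ = N ^ 2 * E := by rw [mul_pow, Real.sq_sqrt hE0]
  rw [inv_mul_le_iff₀ hden]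
  calc ∑ i, d i * z i ^ 2 ≤ ∑ i, d i * (N ^ 2 * E) :=
        Finset.sum_le_sum fun i _ => mul_le_mul_of_nonneg_left (hpoint i) (hd i).le
    _ = D * N ^ 2 * E := by rw [← Finset.sum_mul, mul_assoc]
    _ ≤ (D * N ^ 2 + 1) * E := by linarith

/-! ### Strong monotonicity of the coupling -/

/-- On `[-g, g]`, with `g < π`, the sine is strongly monotone with constant `cos g`. -/
theorem cos_mul_sq_le_sub_mul_sin_sub {g x y : ℝ} (hg : g < π) (hx : |x| ≤ g) (hy : |y| ≤ g) :
    Real.cos g * (x - y) ^ 2 ≤ (x - y) * (Real.sin x - Real.sin y) := by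
  have hmono : MonotoneOn (fun t => Real.sin t - Real.cos g * t) (Set.Icc (-g) g) := by
    have hder : ∀ t, HasDerivAt (fun t => Real.sin t - Real.cos g * t)
        (Real.cos t - Real.cos g) t := fun t =>
       ((Real.hasDerivAt_sin t).sub ((hasDerivAt_id t).const_mul (Real.cos g))).congr_deriv
        (by rw [mul_one])
    refine monotoneOn_of_deriv_nonneg (convex_Icc _ _)
      (fun t _ => (hder t).continuousAt.continuousWithinAt)
      (fun t _ => (hder t).differentiableAt.differentiableWithinAt) fun t ht => ?_
    rw [interior_Icc] at ht
    rw [(hder t).deriv, sub_nonneg, ← Real.cos_abs t]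
    exact Real.cos_le_cos_of_nonneg_of_le_pi (abs_nonneg t) hg.le (abs_lt.2 ht).le
  have hx' : x ∈ Set.Icc (-g) g := abs_le.1 hx
  have hy' : y ∈ Set.Icc (-g) g := abs_le.1 hy
  rcases le_total x y with h | h
  · have := hmono hx' hy' h
    simp only at this
    nlinarith
  · have := hmono hy' hx' h
    simp only at this
    nlinarith

theorem Model.d_mul_freq (M : Model G) (θ : Torus V) (i : V) : M.d i * M.freq θ i = M.f θ i :=
  mul_div_cancel₀ _ (M.d_pos i).ne'

theorem Model.freq_rotate (M : Model G) (c : Real.Angle) (θ : Torus V) :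
    M.freq (rotate c θ) = M.freq θ := by
  funext i
  simp only [Model.freq, Model.f, rotate_sub]

theorem Model.continuous_freq (M : Model G) (i : V) : Continuous fun θ => M.freq θ i := by
  unfold Model.freq Model.f
  refine Continuous.div_const (continuous_const.sub (continuous_finsetSum _ fun j _ => ?_)) _
  exact continuous_const.mul
    (Real.Angle.continuous_sin.comp ((continuous_apply i).sub (continuous_apply j)))

/-- The couplings cancel in pairs, hence the `d`-weighted sum of the frequencies is constant. -/
theorem Model.sum_d_mul_freq (M : Model G) (θ : Torus V) :
    ∑ i, M.d i * M.freq θ i = ∑ i, M.p i := by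
  have h1 : ∑ i, M.d i * M.freq θ i =
      ∑ i, M.p i - dartSum G fun i j => M.a s(i, j) * (θ i - θ j).sin := by
    simp only [Model.d_mul_freq, Model.f, Finset.sum_sub_distrib, dartSum]
  have h2 := dartSum_swap (G := G) fun i j => M.a s(i, j) * (θ i - θ j).sin
  have h3 : (dartSum G fun i j => M.a s(j, i) * (θ j - θ i).sin) =
      -1 * dartSum G fun i j => M.a s(i, j) * (θ i - θ j).sin := by
    rw [← dartSum_mul_left]
    refine dartSum_congr fun i j _ => ?_
    rw [Sym2.eq_swap, ← neg_sub (θ i), Real.Angle.sin_neg]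
    ring
  linarith

/-- Summation by parts for the coupling terms. -/
theorem Model.two_mul_sum_mul_freq_sub (M : Model G) (θ φ : Torus V) (z : V → ℝ) :
    2 * ∑ i, M.d i * (z i * (M.freq θ i - M.freq φ i)) =
      -dartSum G fun i j =>
        M.a s(i, j) * ((z i - z j) * ((θ i - θ j).sin - (φ i - φ j).sin)) := by
  have h1 : ∑ i, M.d i * (z i * (M.freq θ i - M.freq φ i)) =
      -1 * dartSum G fun i j => M.a s(i, j) * (z i * ((θ i - θ j).sin - (φ i - φ j).sin)) := by
    rw [dartSum, Finset.mul_sum]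
    refine Finset.sum_congr rfl fun i _ => ?_
    rw [show M.d i * (z i * (M.freq θ i - M.freq φ i)) =
      z i * (M.d i * M.freq θ i - M.d i * M.freq φ i) by ring, M.d_mul_freq, M.d_mul_freq,
      Model.f, Model.f, sub_sub_sub_cancel_left, ← Finset.sum_sub_distrib, Finset.mul_sum,
      Finset.mul_sum]
    exact Finset.sum_congr rfl fun j _ => by ring
  have h2 := dartSum_swap (G := G) fun i j =>
    M.a s(i, j) * (z i * ((θ i - θ j).sin - (φ i - φ j).sin))
  have h3 : (dartSum G fun i j =>
        M.a s(i, j) * ((z i - z j) * ((θ i - θ j).sin - (φ i - φ j).sin))) =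
      (dartSum G fun i j => M.a s(i, j) * (z i * ((θ i - θ j).sin - (φ i - φ j).sin))) +
      dartSum G fun i j => M.a s(j, i) * (z j * ((θ j - θ i).sin - (φ j - φ i).sin)) := by
    rw [← dartSum_add]
    refine dartSum_congr fun i j _ => ?_
    rw [Sym2.eq_swap (a := j), ← neg_sub (θ i), ← neg_sub (φ i), Real.Angle.sin_neg,
      Real.Angle.sin_neg]
    ring
  rw [h3, h1]
  linarith

/-- Contraction: the vector field is strongly monotone, modulo uniform rotations, between states
with phase differences in the box given by `γ` that differ by a gradient. -/
theorem Model.exists_contraction (M : Model G) (hG : G.Connected) {γ : Sym2 V → ℝ}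
    (hγ : ∀ e ∈ G.edgeSet, γ e ∈ Set.Ioo 0 (π / 2)) :
    ∃ κ > 0, ∀ (θ φ : Torus V) (z : V → ℝ),
      (∀ i j, G.Adj i j → |phaseDiff θ i j| ≤ γ s(i, j)) →
      (∀ i j, G.Adj i j → |phaseDiff φ i j| ≤ γ s(i, j)) →
      (∀ i j, G.Adj i j → z i - z j = phaseDiff θ i j - phaseDiff φ i j) →
      ∑ i, M.d i * z i = 0 →
      ∑ i, M.d i * (z i * (M.freq θ i - M.freq φ i)) ≤ -κ * ∑ i, M.d i * z i ^ 2 := by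
  obtain ⟨κ, hκ, hP⟩ := exists_poincare hG M.d_pos
  obtain ⟨c, hc, hca⟩ := exists_pos_le_of_finite (s := G.edgeSet)
    (f := fun e => M.a e * Real.cos (γ e)) fun e he => mul_pos (M.a_pos e he)
      (Real.cos_pos_of_mem_Ioo ⟨by linarith [(hγ e he).1, Real.pi_pos], (hγ e he).2⟩)
  refine ⟨c * κ / 2, by positivity, fun θ φ z hθ hφ hz hmean => ?_⟩
  have h1 := M.two_mul_sum_mul_freq_sub θ φ z
  have h2 : c * dartSum G (fun i j => (z i - z j) ^ 2) ≤ dartSum G fun i j =>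
      M.a s(i, j) * ((z i - z j) * ((θ i - θ j).sin - (φ i - φ j).sin)) := by
    rw [← dartSum_mul_left]
    refine dartSum_mono fun i j e => ?_
    have hγe := hγ s(i, j) e
    rw [hz i j e, ← sin_phaseDiff, ← sin_phaseDiff]
    calc c * (phaseDiff θ i j - phaseDiff φ i j) ^ 2
        ≤ M.a s(i, j) * Real.cos (γ s(i, j)) * (phaseDiff θ i j - phaseDiff φ i j) ^ 2 :=
          mul_le_mul_of_nonneg_right (hca s(i, j) e) (sq_nonneg _)
      _ ≤ _ := by
          rw [mul_assoc]
          exact mul_le_mul_of_nonneg_left (cos_mul_sq_le_sub_mul_sin_sub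
            (by linarith [hγe.2, Real.pi_pos]) (hθ i j e) (hφ i j e)) (M.a_pos s(i, j) e).le
  have h3 := mul_le_mul_of_nonneg_left (hP z hmean) hc.le
  linarith

/-! ### Scalar differential inequalities and exponential limits -/

/-- If `w' ≤ -κ w` holds whenever `w ≤ r`, and `w` starts at most at `r`, then `w` stays there and
decays exponentially. -/
theorem le_mul_exp_of_trapped {w w' : ℝ → ℝ} {r κ : ℝ} (hr : 0 < r) (hκ : 0 < κ)
    (hw : ∀ t, 0 ≤ t → HasDerivWithinAt w (w' t) (Set.Ici 0) t)
    (hdecay : ∀ t, 0 ≤ t → w t ≤ r → w' t ≤ -κ * w t) (h0 : w 0 ≤ r) {t : ℝ} (ht : 0 ≤ t) :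
    w t ≤ r ∧ w t ≤ w 0 * Real.exp (-κ * t) := by
  have hder : ∀ s ∈ Set.Ico 0 t, HasDerivWithinAt w (w' s) (Set.Ici s) s := fun s hs =>
    (hw s hs.1).mono (Set.Ici_subset_Ici.2 hs.1)
  have hcont : ContinuousOn w (Set.Icc 0 t) := fun s hs =>
    (hw s hs.1).continuousWithinAt.mono Set.Icc_subset_Ici_self
  -- At the level `r` the derivative is at most `-κ r < 0`, so the level cannot be crossed.
  have htrap : ∀ ⦃s⦄, s ∈ Set.Icc 0 t → w s ≤ r :=
    image_le_of_deriv_right_lt_deriv_boundary' hcont hder h0 continuousOn_const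
      (fun s _ => hasDerivWithinAt_const s _ r) fun s hs h => by
        have := hdecay s hs.1 h.le
        rw [h] at this
        nlinarith
  refine ⟨htrap ⟨ht, le_rfl⟩, ?_⟩
  have hexp : ∀ s, HasDerivAt (fun s => Real.exp (κ * s)) (Real.exp (κ * s) * κ) s := fun s => by
    simpa using ((hasDerivAt_id s).const_mul κ).exp
  have hle : w t * Real.exp (κ * t) ≤ w 0 * 1 :=
    image_le_of_deriv_right_le_deriv_boundary (f := fun s => w s * Real.exp (κ * s))
      (hcont.mul fun s _ => (hexp s).continuousAt.continuousWithinAt)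
      (fun s hs => (hder s hs).mul (hexp s).hasDerivWithinAt)
      (by simp) continuousOn_const (fun s _ => hasDerivWithinAt_const s _ _)
      (fun s hs => by
        have h1 := hdecay s hs.1 (htrap ⟨hs.1, hs.2.le⟩)
        nlinarith [Real.exp_pos (κ * s)]) ⟨ht, le_rfl⟩
  rw [neg_mul, Real.exp_neg, ← div_eq_mul_inv, le_div_iff₀ (Real.exp_pos _)]
  linarith

theorem tendsto_exp_neg_mul_atTop {κ : ℝ} (hκ : 0 < κ) (C : ℝ) :
    Tendsto (fun t : ℝ => C * Real.exp (-κ * t)) atTop (𝓝 0) := by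
  have h : Tendsto (fun t : ℝ => -(κ * t)) atTop atBot :=
    tendsto_neg_atTop_atBot.comp (tendsto_id.const_mul_atTop hκ)
  simpa [neg_mul] using (Real.tendsto_exp_atBot.comp h).const_mul C

/-- An exponential Cauchy estimate gives a limit that is approached exponentially. -/
theorem exists_limit_of_exp_cauchy {g : ℝ → ℝ} {C κ : ℝ} (hκ : 0 < κ)
    (h : ∀ t s, 0 ≤ t → 0 ≤ s → |g (t + s) - g t| ≤ C * Real.exp (-κ * t)) :
    ∃ l, ∀ t, 0 ≤ t → |g t - l| ≤ C * Real.exp (-κ * t) := by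
  have h' : ∀ s t, 0 ≤ t → t ≤ s → |g s - g t| ≤ C * Real.exp (-κ * t) := fun s t ht hts => by
    simpa using h t (s - t) ht (sub_nonneg.2 hts)
  have hcauchy : CauchySeq fun n : ℕ => g n := by
    refine cauchySeq_of_le_tendsto_0 (fun n : ℕ => 2 * C * Real.exp (-κ * n)) (fun n m N hn hm => ?_)
      ((tendsto_exp_neg_mul_atTop hκ (2 * C)).comp tendsto_natCast_atTop_atTop)
    have h1 := h' n N N.cast_nonneg (Nat.cast_le.2 hn)
    have h2 := h' m N N.cast_nonneg (Nat.cast_le.2 hm)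
    rw [abs_sub_comm] at h2
    rw [Real.dist_eq]
    linarith [abs_sub_le (g n) (g N) (g m)]
  obtain ⟨l, hl⟩ := cauchySeq_tendsto_of_complete hcauchy
  refine ⟨l, fun t ht => ?_⟩
  refine le_of_tendsto ((tendsto_const_nhds (x := g t)).sub hl).abs ?_
  filter_upwards [eventually_ge_atTop ⌈t⌉₊] with n hn
  rw [abs_sub_comm]
  exact h' n t ht (Nat.ceil_le.1 hn)

/-- If a function and its derivative both converge at infinity, the derivative tends to zero. -/
theorem deriv_limit_eq_zero {g g' : ℝ → ℝ} {l v : ℝ}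
    (hg : ∀ t, 0 ≤ t → HasDerivWithinAt g (g' t) (Set.Ici 0) t)
    (hl : Tendsto g atTop (𝓝 l)) (hv : Tendsto g' atTop (𝓝 v)) : v = 0 := by
  have hmean : ∀ n : ℕ, ∃ c ∈ Set.Ioo (n : ℝ) (n + 1), g' c = (g (n + 1) - g n) / (n + 1 - n) :=
    fun n => exists_hasDerivAt_eq_slope g g' (lt_add_one _)
      (fun t ht => (hg t (n.cast_nonneg.trans ht.1)).continuousWithinAt.mono fun s hs =>
        n.cast_nonneg.trans hs.1)
      fun t ht => (hg t (n.cast_nonneg.trans ht.1.le)).hasDerivAt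
        (Ici_mem_nhds (n.cast_nonneg.trans_lt ht.1))
  choose c hc hslope using hmean
  have hc' : Tendsto c atTop atTop :=
    tendsto_atTop_mono (fun n => (hc n).1.le) tendsto_natCast_atTop_atTop
  have h1 : Tendsto (fun n : ℕ => (g (n + 1) - g n) / ((n : ℝ) + 1 - n)) atTop (𝓝 0) := by
    have h2 : Tendsto (fun n : ℕ => g ((n : ℝ) + 1)) atTop (𝓝 l) :=
      hl.comp (tendsto_atTop_add_const_right _ 1 tendsto_natCast_atTop_atTop)
    have h3 : Tendsto (fun n : ℕ => g n) atTop (𝓝 l) := hl.comp tendsto_natCast_atTop_atTop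
    simpa using h2.sub h3
  exact tendsto_nhds_unique ((hv.comp hc').congr hslope) h1

/-! ### Synchronous orbits -/

theorem eq_add_mul_of_hasDeriv_const {g : ℝ → ℝ} {ω : ℝ}
    (hg : ∀ t, 0 ≤ t → HasDerivWithinAt g ω (Set.Ici 0) t) {t : ℝ} (ht : 0 ≤ t) :
    g t = g 0 + ω * t := by
  have hder : ∀ s, 0 ≤ s → HasDerivWithinAt (fun s => g s - ω * s) 0 (Set.Ici 0) s := fun s hs =>
    ((hg s hs).sub ((hasDerivAt_id s).const_mul ω).hasDerivWithinAt).congr_deriv (by simp)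
  have h := constant_of_has_deriv_right_zero (f := fun s => g s - ω * s) (a := 0) (b := t)
    (fun s hs => (hder s hs.1).continuousWithinAt.mono Set.Icc_subset_Ici_self)
    (fun s hs => (hder s hs.1).mono (Set.Ici_subset_Ici.2 hs.1)) t ⟨ht, le_rfl⟩
  simp only [mul_zero, sub_zero] at h
  linarith

/-- The only possible frequency of a synchronous solution, `∑ p / ∑ d`. -/
def Model.syncFreq (M : Model G) : ℝ := (∑ i, M.p i) / ∑ i, M.d i

theorem Model.sum_d_pos [Nonempty V] (M : Model G) : 0 < ∑ i, M.d i :=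
  Finset.sum_pos (fun i _ => M.d_pos i) Finset.univ_nonempty

theorem Model.sum_d_mul_syncFreq [Nonempty V] (M : Model G) :
    (∑ i, M.d i) * M.syncFreq = ∑ i, M.p i :=
  mul_div_cancel₀ _ M.sum_d_pos.ne'

theorem Model.eq_syncFreq [Nonempty V] (M : Model G) {θ : Torus V} {ω : ℝ}
    (h : ∀ i, M.freq θ i = ω) : ω = M.syncFreq := by
  have h1 := M.sum_d_mul_freq θ
  simp only [h, ← Finset.sum_mul, ← M.sum_d_mul_syncFreq] at h1
  exact mul_left_cancel₀ M.sum_d_pos.ne' h1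

/-- The forward orbit of `φ` under uniform rotation at the synchronous frequency. -/
def Model.syncOrbit (M : Model G) (φ : Torus V) : Set (Torus V) :=
  (fun t : ℝ => rotate ((M.syncFreq * t : ℝ) : Real.Angle) φ) '' Set.Ici 0

theorem Model.mem_syncOrbit (M : Model G) (φ : Torus V) : φ ∈ M.syncOrbit φ :=
  ⟨0, Set.mem_Ici.2 le_rfl, by funext i; simp [rotate]⟩

theorem Model.isSyncLimitCycle_syncOrbit (M : Model G) {φ : Torus V}
    (h : ∀ i, M.freq φ i = M.syncFreq) : M.IsSyncLimitCycle (M.syncOrbit φ) := by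
  refine ⟨fun t => rotate ((M.syncFreq * t : ℝ) : Real.Angle) φ,
    ⟨fun t i => (φ i).toReal + M.syncFreq * t, fun t _ i => ?_, fun t _ i => ?_⟩,
    ⟨M.syncFreq, fun t _ i => by rw [M.freq_rotate, h i]⟩, rfl⟩
  · simp only [rotate, Real.Angle.coe_add, Real.Angle.coe_toReal]
  · rw [M.freq_rotate, h i]
    exact (((hasDerivAt_id t).const_mul M.syncFreq).const_add _).hasDerivWithinAt.congr_deriv
      (mul_one _)

/-- Lifts of a synchronous solution are affine in time, so that its orbit consists of rotations of
its starting point. -/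
theorem Model.IsSyncLimitCycle.eq_syncOrbit [Nonempty V] {M : Model G} {Γ : Set (Torus V)}
    (h : M.IsSyncLimitCycle Γ) :
    ∃ φ, (∀ i, M.freq φ i = M.syncFreq) ∧ Γ = M.syncOrbit φ := by
  obtain ⟨θ, ⟨x, hx, hder⟩, ⟨ω, hω⟩, rfl⟩ := h
  obtain rfl : ω = M.syncFreq := M.eq_syncFreq (hω 0 le_rfl)
  refine ⟨θ 0, hω 0 le_rfl, Set.image_congr fun t ht => ?_⟩
  funext i
  have h1 := eq_add_mul_of_hasDeriv_const (g := fun s => x s i) (ω := M.syncFreq)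
    (fun s hs => (hder s hs i).congr_deriv (hω s hs i)) ht
  rw [hx t ht i, h1, Real.Angle.coe_add, rotate, hx 0 le_rfl i]

theorem Model.rotate_mem_rotationOrbit (M : Model G) (c : Real.Angle) (φ : Torus V) :
    rotate c φ ∈ rotationOrbit (M.syncOrbit φ) := ⟨c, φ, M.mem_syncOrbit φ, rfl⟩

theorem Model.exists_rotate_of_mem_rotationOrbit (M : Model G) {φ ψ : Torus V}
    (h : ψ ∈ rotationOrbit (M.syncOrbit φ)) : ∃ c, ψ = rotate c φ := by
  obtain ⟨c, _, ⟨t, _, rfl⟩, rfl⟩ := h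
  exact ⟨_, rotate_rotate _ _ _⟩

/-- The `d`-weighted mean of a lifted trajectory moves at the synchronous frequency. -/
theorem Model.sum_d_mul_lift [Nonempty V] (M : Model G) {θ : ℝ → Torus V} {x : ℝ → V → ℝ}
    (hx : ∀ t, 0 ≤ t → ∀ i, HasDerivWithinAt (fun s => x s i) (M.freq (θ t) i) (Set.Ici 0) t)
    {t : ℝ} (ht : 0 ≤ t) :
    ∑ i, M.d i * x t i = ∑ i, M.d i * x 0 i + (∑ i, M.d i) * (M.syncFreq * t) := by
  rw [← mul_assoc, M.sum_d_mul_syncFreq]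
  refine eq_add_mul_of_hasDeriv_const (g := fun s => ∑ i, M.d i * x s i) (fun s hs => ?_) ht
  rw [← M.sum_d_mul_freq (θ s)]
  exact HasDerivWithinAt.fun_sum fun i _ => (hx s hs i).const_mul (M.d i)

theorem exists_centering [Nonempty V] (M : Model G) (z : V → ℝ) :
    ∃ m, ∑ i, M.d i * (z i - m) = 0 :=
  ⟨(∑ i, M.d i * z i) / ∑ i, M.d i, by
    simp only [mul_sub, Finset.sum_sub_distrib, ← Finset.sum_mul]
    rw [mul_div_cancel₀ _ M.sum_d_pos.ne', sub_self]⟩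

/-! ### Uniqueness of synchronous states in a winding cell -/

/-- Two cohesive synchronous states in one winding cell are rotations of each other: the gradient
between their phase differences is not dissipated, hence zero. -/
theorem Model.exists_rotate_eq_of_sync (M : Model G) (hG : G.Connected)
    {S : Set (SimpleCycle G)} (hS : IsCycleBasis S) {γ : Sym2 V → ℝ}
    (hγ : ∀ e ∈ G.edgeSet, γ e ∈ Set.Ioo 0 (π / 2)) {u : S → ℝ} {θ φ : Torus V}
    (hθ : θ ∈ windingCell S u ∩ cohesiveSet G γ) (hφ : φ ∈ windingCell S u ∩ cohesiveSet G γ)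
    (hθf : ∀ i, M.freq θ i = M.syncFreq) (hφf : ∀ i, M.freq φ i = M.syncFreq) :
    ∃ c, φ = rotate c θ := by
  have := hG.nonempty
  obtain ⟨κ, hκ, hcontr⟩ := M.exists_contraction hG hγ
  obtain ⟨z, hz⟩ := exists_gradient hG hS hθ.1 hφ.1
    (abs_phaseDiff_lt_pi_div_two hγ hθ.2) (abs_phaseDiff_lt_pi_div_two hγ hφ.2)
  obtain ⟨m, hm⟩ := exists_centering M z
  have h := hcontr θ φ (fun i => z i - m)
    (fun i j e => (mem_cohesiveSet_iff.1 hθ.2 i j e).le)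
    (fun i j e => (mem_cohesiveSet_iff.1 hφ.2 i j e).le)
    (fun i j e => by rw [← hz i j e]; ring) hm
  simp only [hθf, hφf, sub_self, mul_zero, Finset.sum_const_zero] at h
  have hsum : ∑ i, M.d i * (z i - m) ^ 2 ≤ 0 := by nlinarith
  have hnonneg : ∀ i ∈ Finset.univ, 0 ≤ M.d i * (z i - m) ^ 2 := fun i _ =>
    mul_nonneg (M.d_pos i).le (sq_nonneg _)
  have hzero : ∀ i, z i = m := fun i => by
    have h0 := (Finset.sum_eq_zero_iff_of_nonneg hnonneg).1
      (le_antisymm hsum (Finset.sum_nonneg hnonneg)) i (Finset.mem_univ i)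
    have h1 := (mul_eq_zero.1 h0).resolve_left (M.d_pos i).ne'
    exact sub_eq_zero.1 (pow_eq_zero_iff two_ne_zero |>.1 h1)
  obtain ⟨r⟩ := hG.nonempty
  refine ⟨φ r - θ r, funext fun i => ?_⟩
  have hconst : φ i - θ i = φ r - θ r := by
    refine eq_of_forall_adj hG (f := fun i => φ i - θ i) (fun i j e => ?_) i r
    have h1 := hz i j e
    rw [hzero i, hzero j, sub_self, eq_comm, sub_eq_zero] at h1
    have h2 : θ i - θ j = φ i - φ j := Real.Angle.toReal_injective h1
    rw [sub_eq_sub_iff_sub_eq_sub, h2]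
  rw [rotate, ← hconst]
  abel

/-! ### Exponential decay of the centred deviation -/

/-- If a curve `z` in `ℝⁿ` dissipates its `d`-weighted energy as long as that energy is at most `r`,
and the energy starts at most at `r`, then the energy stays below `r` and `z` decays
exponentially. -/
theorem abs_le_of_dissipation {d : V → ℝ} {ρ r κ : ℝ} (hρ : 0 < ρ) (hd : ∀ i, ρ ≤ d i)
    (hr : 0 < r) (hκ : 0 < κ) {z v : ℝ → V → ℝ}
    (hz : ∀ t, 0 ≤ t → ∀ i, HasDerivWithinAt (fun s => z s i) (v t i) (Set.Ici 0) t)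
    (hdiss : ∀ t, 0 ≤ t → ∑ i, d i * z t i ^ 2 ≤ r →
      ∑ i, d i * (z t i * v t i) ≤ -κ * ∑ i, d i * z t i ^ 2)
    (h0 : ∑ i, d i * z 0 i ^ 2 ≤ r) {t : ℝ} (ht : 0 ≤ t) (i : V) :
    |z t i| ≤ √((∑ i, d i * z 0 i ^ 2) / ρ) * Real.exp (-κ * t) := by
  have hw : ∀ t, 0 ≤ t → HasDerivWithinAt (fun s => ∑ i, d i * z s i ^ 2)
      (2 * ∑ i, d i * (z t i * v t i)) (Set.Ici 0) t := fun t ht => by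
    rw [Finset.mul_sum]
    exact HasDerivWithinAt.fun_sum fun i _ =>
      (((hz t ht i).pow 2).const_mul (d i)).congr_deriv (by push_cast; ring)
  have hdecay := (le_mul_exp_of_trapped hr (mul_pos two_pos hκ) hw
    (fun t ht h => by linarith [hdiss t ht h]) h0 ht).2
  have hterm : ρ * z t i ^ 2 ≤ ∑ i, d i * z t i ^ 2 :=
    (mul_le_mul_of_nonneg_right (hd i) (sq_nonneg _)).trans
      (Finset.single_le_sum (f := fun i => d i * z t i ^ 2)
        (fun i _ => mul_nonneg (hρ.le.trans (hd i)) (sq_nonneg _)) (Finset.mem_univ i))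
  have hexp : Real.exp (-(2 * κ) * t) = Real.exp (-κ * t) ^ 2 := by
    rw [← Real.exp_nat_mul]
    congr 1
    push_cast
    ring
  have hsq : z t i ^ 2 ≤ (∑ i, d i * z 0 i ^ 2) / ρ * Real.exp (-κ * t) ^ 2 := by
    rw [← hexp, div_mul_eq_mul_div, le_div_iff₀ hρ]
    linarith
  refine (Real.abs_le_sqrt hsq).trans_eq ?_
  rw [Real.sqrt_mul' _ (sq_nonneg _), Real.sqrt_sq (Real.exp_pos _).le]

/-! ### Stability of synchronous orbits -/

theorem dist_le_of_lift {θ φ : Torus V} {z : V → ℝ} {c : Real.Angle} {r : ℝ} (hr : 0 ≤ r)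
    (h : ∀ i, θ i = φ i + z i + c) (hz : ∀ i, |z i| ≤ r) : dist θ (rotate c φ) ≤ r := by
  refine (dist_pi_le_iff hr).2 fun i => ?_
  have h1 : θ i - rotate c φ i = z i := by rw [h i, rotate]; abel
  rw [dist_eq_norm, h1]
  exact (norm_coe_angle_le _).trans (hz i)

/-- Local exponential stability, modulo rotations, of a cohesive synchronous state. -/
theorem Model.infDist_rotationOrbit_le (M : Model G) (hG : G.Connected) {γ : Sym2 V → ℝ}
    (hγ : ∀ e ∈ G.edgeSet, γ e ∈ Set.Ioo 0 (π / 2)) {φ : Torus V} (hφ : φ ∈ cohesiveSet G γ)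
    (hφf : ∀ i, M.freq φ i = M.syncFreq) :
    ∃ δ₀ > 0, ∃ L > 0, ∃ κ > 0, ∀ θ : ℝ → Torus V, M.IsTrajectory θ → ∀ δ ≤ δ₀,
      Metric.infDist (θ 0) (rotationOrbit (M.syncOrbit φ)) < δ → ∀ t, 0 ≤ t →
      Metric.infDist (θ t) (rotationOrbit (M.syncOrbit φ)) ≤ L * δ * Real.exp (-κ * t) := by
  have := hG.nonempty
  obtain ⟨κ, hκ, hcontr⟩ := M.exists_contraction hG hγ
  obtain ⟨ρ, hρ, hρd⟩ := exists_pos_le_of_finite (s := Set.univ) (f := M.d) fun i _ => M.d_pos i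
  -- `η` is the distance of the phase differences of `φ` to the boundary of the box.
  obtain ⟨η, hη, hηγ⟩ := exists_pos_le_of_finite (s := {q : V × V | G.Adj q.1 q.2})
    (f := fun q => γ s(q.1, q.2) - |phaseDiff φ q.1 q.2|)
    fun q hq => sub_pos.2 (mem_cohesiveSet_iff.1 hφ _ _ hq)
  have hD := M.sum_d_pos
  set D := ∑ i, M.d i with hDdef
  refine ⟨η / 4 * √(ρ / D), by positivity, 2 * √(D / ρ), by positivity, κ, hκ, ?_⟩
  rintro θ ⟨x, hx, hder⟩ δ hδ hdist t ht
  have hδ0 : 0 < δ := Metric.infDist_nonneg.trans_lt hdist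
  obtain ⟨ψ, hψ, hψδ⟩ := (Metric.infDist_lt_iff ⟨_, M.rotate_mem_rotationOrbit 0 φ⟩).1 hdist
  obtain ⟨c, rfl⟩ := M.exists_rotate_of_mem_rotationOrbit hψ
  let e : V → ℝ := fun i => (θ 0 i - rotate c φ i).toReal
  have he : ∀ i, |e i| ≤ δ := fun i => by
    rw [← norm_angle_eq_abs_toReal, ← dist_eq_norm]
    exact (dist_le_pi_dist _ _ i).trans hψδ.le
  obtain ⟨m, hm⟩ := exists_centering M e
  have hmδ : |m| ≤ δ := by
    have h1 : D * m = ∑ i, M.d i * e i := by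
      simp only [mul_sub, Finset.sum_sub_distrib, ← Finset.sum_mul] at hm
      linarith
    have h2 : |D * m| ≤ D * δ := by
      rw [h1, hDdef, Finset.sum_mul]
      refine (Finset.abs_sum_le_sum_abs _ _).trans (Finset.sum_le_sum fun i _ => ?_)
      rw [abs_mul, abs_of_pos (M.d_pos i)]
      exact mul_le_mul_of_nonneg_left (he i) (M.d_pos i).le
    rw [abs_mul, abs_of_pos hD] at h2
    exact le_of_mul_le_mul_left h2 hD
  -- The deviation from the synchronous solution, lifted to `ℝⁿ` and centred.
  let z : ℝ → V → ℝ := fun t i => e i - m + (x t i - x 0 i - M.syncFreq * t)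
  have hz0 : ∀ i, z 0 i = e i - m := fun i => by simp [z]
  have hlift : ∀ t, 0 ≤ t → ∀ i,
      θ t i = φ i + z t i + ((m + M.syncFreq * t : ℝ) + c) := fun t ht i => by
    have h1 : ((e i : ℝ) : Real.Angle) = θ 0 i - (φ i + c) := Real.Angle.coe_toReal _
    simp only [z, Real.Angle.coe_add, Real.Angle.coe_sub, h1, hx t ht i, hx 0 le_rfl i]
    abel
  have hmean : ∀ t, 0 ≤ t → ∑ i, M.d i * z t i = 0 := fun t ht => by
    have h1 := M.sum_d_mul_lift hder ht
    simp only [z, mul_add, hm, Finset.sum_add_distrib, mul_sub (_ : ℝ) (_ - _ : ℝ),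
      Finset.sum_sub_distrib, ← Finset.sum_mul]
    simp only [mul_sub, Finset.sum_sub_distrib] at hm ⊢
    linarith
  have hzder : ∀ t, 0 ≤ t → ∀ i, HasDerivWithinAt (fun s => z s i)
      (M.freq (θ t) i - M.freq φ i) (Set.Ici 0) t := fun t ht i => by
    rw [hφf i]
    exact ((((hder t ht i).sub_const (x 0 i)).sub
      ((hasDerivAt_id t).const_mul M.syncFreq).hasDerivWithinAt).const_add (e i - m)).congr_deriv
      (by rw [mul_one])
  have hw0 : ∑ i, M.d i * z 0 i ^ 2 ≤ D * (2 * δ) ^ 2 := by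
    rw [hDdef, Finset.sum_mul]
    refine Finset.sum_le_sum fun i _ => mul_le_mul_of_nonneg_left ?_ (M.d_pos i).le
    rw [hz0, ← sq_abs]
    refine pow_le_pow_left₀ (abs_nonneg _) ?_ 2
    linarith [abs_sub (e i) m, he i]
  have hδr : D * (2 * δ) ^ 2 ≤ ρ * (η / 2) ^ 2 := by
    have h1 : δ ^ 2 ≤ (η / 4 * √(ρ / D)) ^ 2 := pow_le_pow_left₀ hδ0.le hδ 2
    rw [mul_pow, Real.sq_sqrt (by positivity)] at h1
    calc D * (2 * δ) ^ 2 = 4 * D * δ ^ 2 := by ring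
      _ ≤ 4 * D * ((η / 4) ^ 2 * (ρ / D)) := mul_le_mul_of_nonneg_left h1 (by positivity)
      _ = ρ * (η / 2) ^ 2 := by field_simp; ring
  -- Below the energy level `ρ (η / 2) ^ 2` the phase differences of `θ` remain in the box.
  have hdiss : ∀ t, 0 ≤ t → ∑ i, M.d i * z t i ^ 2 ≤ ρ * (η / 2) ^ 2 →
      ∑ i, M.d i * (z t i * (M.freq (θ t) i - M.freq φ i)) ≤ -κ * ∑ i, M.d i * z t i ^ 2 := by
    intro t ht hle
    have hzi : ∀ i, |z t i| ≤ η / 2 := fun i => by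
      have h1 : M.d i * z t i ^ 2 ≤ ρ * (η / 2) ^ 2 := (Finset.single_le_sum
        (f := fun i => M.d i * z t i ^ 2)
        (fun i _ => mul_nonneg (M.d_pos i).le (sq_nonneg _)) (Finset.mem_univ i)).trans hle
      have h2 : ρ * z t i ^ 2 ≤ ρ * (η / 2) ^ 2 :=
        (mul_le_mul_of_nonneg_right (hρd i trivial) (sq_nonneg _)).trans h1
      exact abs_le_of_sq_le_sq (le_of_mul_le_mul_left h2 hρ) (by positivity)
    have hbox : ∀ i j, G.Adj i j → |phaseDiff φ i j + (z t i - z t j)| ≤ γ s(i, j) :=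
      fun i j hij => by
        have h1 : η ≤ γ s(i, j) - |phaseDiff φ i j| := hηγ (i, j) hij
        linarith [abs_add_le (phaseDiff φ i j) (z t i - z t j), abs_sub (z t i) (z t j), hzi i, hzi j]
    have hpd : ∀ i j, G.Adj i j →
        phaseDiff (θ t) i j = phaseDiff φ i j + (z t i - z t j) := fun i j hij =>
      phaseDiff_eq_add (hlift t ht)
        ((hbox i j hij).trans_lt (by linarith [(hγ s(i, j) hij).2, Real.pi_pos]))
    exact hcontr (θ t) φ (z t) (fun i j hij => by rw [hpd i j hij]; exact hbox i j hij)
      (fun i j hij => (mem_cohesiveSet_iff.1 hφ i j hij).le)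
      (fun i j hij => by rw [hpd i j hij]; ring) (hmean t ht)
  have hbound : ∀ i, |z t i| ≤ 2 * √(D / ρ) * δ * Real.exp (-κ * t) := fun i => by
    refine (abs_le_of_dissipation hρ (fun i => hρd i trivial) (by positivity) hκ hzder hdiss
      (hw0.trans hδr) ht i).trans (mul_le_mul_of_nonneg_right ?_ (Real.exp_pos _).le)
    rw [show 2 * √(D / ρ) * δ = √(D / ρ * (2 * δ) ^ 2) by
      rw [Real.sqrt_mul' _ (sq_nonneg _), Real.sqrt_sq (by positivity)]; ring]
    refine Real.sqrt_le_sqrt ?_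
    rw [div_mul_eq_mul_div]
    exact div_le_div_of_nonneg_right hw0 hρ.le
  exact (Metric.infDist_le_dist_of_mem (M.rotate_mem_rotationOrbit _ φ)).trans
    (dist_le_of_lift (by positivity) (hlift t ht) hbound)

theorem Model.isAsymptoticallyStable_rotationOrbit (M : Model G) (hG : G.Connected)
    {γ : Sym2 V → ℝ} (hγ : ∀ e ∈ G.edgeSet, γ e ∈ Set.Ioo 0 (π / 2)) {φ : Torus V}
    (hφ : φ ∈ cohesiveSet G γ) (hφf : ∀ i, M.freq φ i = M.syncFreq) :
    M.IsAsymptoticallyStable (rotationOrbit (M.syncOrbit φ)) := by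
  obtain ⟨δ₀, hδ₀, L, hL, κ, hκ, h⟩ := M.infDist_rotationOrbit_le hG hγ hφ hφf
  refine ⟨fun ε hε => ⟨min δ₀ (ε / (2 * L)), by positivity, fun θ hθ h0 t ht => ?_⟩,
    δ₀, hδ₀, fun θ hθ h0 => ?_⟩
  · refine (h θ hθ _ (min_le_left _ _) h0 t ht).trans_lt ?_
    have h1 : Real.exp (-κ * t) ≤ 1 :=
      Real.exp_le_one_iff.2 (mul_nonpos_of_nonpos_of_nonneg (by linarith) ht)
    have hδpos : 0 < min δ₀ (ε / (2 * L)) := by positivity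
    calc L * min δ₀ (ε / (2 * L)) * Real.exp (-κ * t)
        ≤ L * min δ₀ (ε / (2 * L)) * 1 := mul_le_mul_of_nonneg_left h1 (by positivity)
      _ ≤ L * (ε / (2 * L)) := by
          rw [mul_one]
          exact mul_le_mul_of_nonneg_left (min_le_right _ _) hL.le
      _ = ε / 2 := by field_simp
      _ < ε := half_lt_self hε
  · refine tendsto_of_tendsto_of_tendsto_of_le_of_le' tendsto_const_nhds
      (tendsto_exp_neg_mul_atTop hκ (L * δ₀)) (Eventually.of_forall fun _ => Metric.infDist_nonneg) ?_
    filter_upwards [eventually_ge_atTop 0] with t ht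
    exact h θ hθ δ₀ le_rfl h0 t ht

/-! ### Convergence of trajectories that remain cohesive -/

/-- A trajectory that remains cohesive is compared with its own time shifts: the contraction makes
it, in the frame that rotates at the synchronous frequency, exponentially Cauchy. -/
theorem Model.exists_limit_lift (M : Model G) (hG : G.Connected) {γ : Sym2 V → ℝ}
    (hγ : ∀ e ∈ G.edgeSet, γ e ∈ Set.Ioo 0 (π / 2)) {θ : ℝ → Torus V} {x : ℝ → V → ℝ}
    (hx : ∀ t, 0 ≤ t → ∀ i, θ t i = (x t i : Real.Angle))
    (hder : ∀ t, 0 ≤ t → ∀ i,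
      HasDerivWithinAt (fun s => x s i) (M.freq (θ t) i) (Set.Ici 0) t)
    (hθ : ∀ t, 0 ≤ t → θ t ∈ cohesiveSet G γ) :
    ∃ l : V → ℝ, ∃ C, ∃ κ > 0, 0 ≤ C ∧
      ∀ t, 0 ≤ t → ∀ i, |x t i - M.syncFreq * t - l i| ≤ C * Real.exp (-κ * t) := by
  have := hG.nonempty
  obtain ⟨κ, hκ, hcontr⟩ := M.exists_contraction hG hγ
  obtain ⟨lam, hlam, hpoincare⟩ := exists_poincare hG M.d_pos
  obtain ⟨ρ, hρ, hρd⟩ := exists_pos_le_of_finite (s := Set.univ) (f := M.d) fun i _ => M.d_pos i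
  have hcont : ∀ i, ContinuousOn (fun t => x t i) (Set.Ici 0) := fun i t ht =>
    (hder t ht i).continuousWithinAt
  have hpd : ∀ i j, G.Adj i j → ∀ t, 0 ≤ t →
      phaseDiff (θ t) i j - phaseDiff (θ 0) i j = x t i - x t j - (x 0 i - x 0 j) :=
    fun i j e t ht => phaseDiff_sub_phaseDiff_zero hx hcont
      (fun s hs => abs_phaseDiff_lt_pi_div_two hγ (hθ s hs) i j e) ht
  let E := dartSum G fun _ _ => π ^ 2
  have hmain : ∀ s t, 0 ≤ s → 0 ≤ t → ∀ i, |x (t + s) i - x t i - M.syncFreq * s| ≤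
      √(E / lam / ρ) * Real.exp (-κ * t) := by
    intro s t hs ht i
    let z : ℝ → V → ℝ := fun t i => x (t + s) i - x t i - M.syncFreq * s
    have hgrad : ∀ t, 0 ≤ t → ∀ i j, G.Adj i j →
        z t i - z t j = phaseDiff (θ (t + s)) i j - phaseDiff (θ t) i j := fun t ht i j e => by
      have h1 := hpd i j e t ht
      have h2 := hpd i j e (t + s) (add_nonneg ht hs)
      simp only [z]
      linarith
    have hmean : ∀ t, 0 ≤ t → ∑ i, M.d i * z t i = 0 := fun t ht => by
      have h1 := M.sum_d_mul_lift hder ht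
      have h2 := M.sum_d_mul_lift hder (add_nonneg ht hs)
      simp only [z, mul_sub, Finset.sum_sub_distrib, ← Finset.sum_mul]
      linarith
    have hzder : ∀ t, 0 ≤ t → ∀ i, HasDerivWithinAt (fun τ => z τ i)
        (M.freq (θ (t + s)) i - M.freq (θ t) i) (Set.Ici 0) t := fun t ht i => by
      have hmaps : Set.MapsTo (fun τ => τ + s) (Set.Ici 0) (Set.Ici 0) := fun τ hτ =>
        add_nonneg (Set.mem_Ici.1 hτ) hs
      have hshift : HasDerivWithinAt (fun τ => τ + s) 1 (Set.Ici 0) t :=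
        ((hasDerivAt_id t).add_const s).hasDerivWithinAt
      have h1 : HasDerivWithinAt (fun τ => x (τ + s) i) (M.freq (θ (t + s)) i * 1)
          (Set.Ici 0) t :=
        HasDerivWithinAt.comp (h₂ := fun τ => x τ i) t (hder (t + s) (add_nonneg ht hs) i)
          hshift hmaps
      rw [mul_one] at h1
      exact (h1.sub (hder t ht i)).sub_const _
    have hw0 : ∑ i, M.d i * z 0 i ^ 2 ≤ E / lam := by
      rw [le_div_iff₀ hlam, mul_comm]
      refine (hpoincare (z 0) (hmean 0 le_rfl)).trans (dartSum_mono fun i j e => ?_)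
      rw [hgrad 0 le_rfl i j e]
      have h1 := abs_phaseDiff_lt_pi_div_two hγ (hθ (0 + s) (by linarith)) i j e
      have h2 := abs_phaseDiff_lt_pi_div_two hγ (hθ 0 le_rfl) i j e
      refine sq_le_sq' ?_ ?_ <;> linarith [abs_lt.1 h1, abs_lt.1 h2]
    refine (abs_le_of_dissipation hρ (fun i => hρd i trivial)
      (r := max 1 (∑ i, M.d i * z 0 i ^ 2)) (by positivity) hκ hzder
      (fun t ht _ => hcontr _ _ (z t)
        (fun i j e => (mem_cohesiveSet_iff.1 (hθ (t + s) (add_nonneg ht hs)) i j e).le)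
        (fun i j e => (mem_cohesiveSet_iff.1 (hθ t ht) i j e).le) (hgrad t ht) (hmean t ht))
      (le_max_right _ _) ht i).trans (mul_le_mul_of_nonneg_right ?_ (Real.exp_pos _).le)
    exact Real.sqrt_le_sqrt (div_le_div_of_nonneg_right hw0 hρ.le)
  have hlim : ∀ i, ∃ l, ∀ t, 0 ≤ t →
      |x t i - M.syncFreq * t - l| ≤ √(E / lam / ρ) * Real.exp (-κ * t) := fun i =>
    exists_limit_of_exp_cauchy (g := fun t => x t i - M.syncFreq * t) hκ fun t s ht hs => by
      rw [show x (t + s) i - M.syncFreq * (t + s) - (x t i - M.syncFreq * t) =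
        x (t + s) i - x t i - M.syncFreq * s by ring]
      exact hmain s t hs ht i
  choose l hl using hlim
  exact ⟨l, _, κ, hκ, Real.sqrt_nonneg _, fun t ht i => hl i t ht⟩

/-- A trajectory that remains cohesive converges exponentially to the orbit of its limit in the
rotating frame. The limit lies in the closed box of phase differences, still inside `(-π, π)`, so
that the winding numbers persist. -/
theorem Model.exists_limitCycle (M : Model G) (hG : G.Connected) {γ : Sym2 V → ℝ}
    (hγ : ∀ e ∈ G.edgeSet, γ e ∈ Set.Ioo 0 (π / 2)) (S : Set (SimpleCycle G))
    {θ : ℝ → Torus V} (htraj : M.IsTrajectory θ) (hθ : ∀ t, 0 ≤ t → θ t ∈ cohesiveSet G γ) :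
    ∃ Γ, M.IsSyncLimitCycle Γ ∧
      Γ ⊆ windingCell S (windingVector S (θ 0)) ∩ closure (cohesiveSet G γ) ∧
      ConvergesExponentially θ Γ := by
  obtain ⟨x, hx, hder⟩ := htraj
  obtain ⟨l, C, κ, hκ, hC, hl⟩ := M.exists_limit_lift hG hγ hx hder hθ
  have htend : ∀ i, Tendsto (fun t => x t i - M.syncFreq * t) atTop (𝓝 (l i)) := fun i => by
    refine tendsto_iff_dist_tendsto_zero.2 (squeeze_zero' (Eventually.of_forall fun _ => dist_nonneg)
      ?_ (tendsto_exp_neg_mul_atTop hκ C))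
    filter_upwards [eventually_ge_atTop 0] with t ht
    exact hl t ht i
  let φ : Torus V := fun i => (l i : Real.Angle)
  -- In the rotating frame the trajectory converges to `φ`.
  have hconv : ∀ a : Real.Angle, Tendsto
      (fun t => rotate (a - (M.syncFreq * t : ℝ)) (θ t)) atTop (𝓝 (rotate a φ)) := fun a => by
    refine tendsto_pi_nhds.2 fun i => ?_
    have h1 : Tendsto (fun t => ((x t i - M.syncFreq * t : ℝ) : Real.Angle) + a) atTop
        (𝓝 (rotate a φ i)) :=
      ((Real.Angle.continuous_coe.tendsto _).comp (htend i)).add_const a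
    refine h1.congr' ?_
    filter_upwards [eventually_ge_atTop 0] with t ht
    rw [rotate, hx t ht i, Real.Angle.coe_sub]
    abel
  have hφf : ∀ i, M.freq φ i = M.syncFreq := fun i => by
    have h1 : Tendsto (fun t => M.freq (θ t) i) atTop (𝓝 (M.freq φ i)) := by
      have h2 := ((M.continuous_freq i).tendsto _).comp (hconv 0)
      simpa only [Function.comp_def, M.freq_rotate] using h2
    exact sub_eq_zero.1 (deriv_limit_eq_zero (g := fun t => x t i - M.syncFreq * t)
      (fun t ht => ((hder t ht i).sub
        ((hasDerivAt_id t).const_mul M.syncFreq).hasDerivWithinAt).congr_deriv (by rw [mul_one]))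
      (htend i) (h1.sub_const M.syncFreq))
  have hcont : ∀ i, ContinuousOn (fun t => x t i) (Set.Ici 0) := fun i t ht =>
    (hder t ht i).continuousWithinAt
  have hpd : ∀ i j, G.Adj i j → phaseDiff φ i j =
      phaseDiff (θ 0) i j + ((l i - x 0 i) - (l j - x 0 j)) := fun i j e => by
    have hbound : |phaseDiff (θ 0) i j + ((l i - x 0 i) - (l j - x 0 j))| ≤ γ s(i, j) := by
      refine le_of_tendsto ((((htend i).sub_const (x 0 i)).sub
        ((htend j).sub_const (x 0 j))).const_add (phaseDiff (θ 0) i j)).abs ?_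
      filter_upwards [eventually_ge_atTop 0] with t ht
      have h1 := phaseDiff_sub_phaseDiff_zero hx hcont
        (fun s hs => abs_phaseDiff_lt_pi_div_two hγ (hθ s hs) i j e) ht
      rw [show phaseDiff (θ 0) i j + ((x t i - M.syncFreq * t - x 0 i) -
        (x t j - M.syncFreq * t - x 0 j)) = phaseDiff (θ t) i j by linarith]
      exact (mem_cohesiveSet_iff.1 (hθ t ht) i j e).le
    refine phaseDiff_eq_add (z := fun i => l i - x 0 i) (c := 0) (fun k => ?_)
      (hbound.trans_lt (by linarith [(hγ s(i, j) e).2, Real.pi_pos]))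
    rw [hx 0 le_rfl k, ← Real.Angle.coe_add, add_zero, add_sub_cancel]
  refine ⟨M.syncOrbit φ, M.isSyncLimitCycle_syncOrbit hφf, ?_, C, κ, hκ, fun t ht => ?_⟩
  · rintro _ ⟨s, _, rfl⟩
    refine ⟨funext fun c => windingNumber_eq_of_gradient (z := fun i => l i - x 0 i)
      (fun i j e => ?_) c.1, mem_closure_of_tendsto (hconv _) ?_⟩
    · rw [phaseDiff_rotate, hpd i j e]
      ring
    · filter_upwards [eventually_ge_atTop 0] with t ht
      exact rotate_mem_cohesiveSet _ (hθ t ht)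
  · refine (Metric.infDist_le_dist_of_mem (Set.mem_image_of_mem _ (Set.mem_Ici.2 ht))).trans
      (dist_le_of_lift (z := fun i => x t i - M.syncFreq * t - l i) (by positivity)
        (fun i => ?_) fun i => hl t ht i)
    rw [hx t ht i, ← Real.Angle.coe_add, ← Real.Angle.coe_add]
    congr 1
    ring

end Kuramoto

end

theorem theorem1 {V : Type*} [Fintype V] (G : SimpleGraph V) (hG : G.Connected)
    (M : Kuramoto.Model G)
    (S : Set (Kuramoto.SimpleCycle G)) (hS : Kuramoto.IsCycleBasis S)
    (γ : Sym2 V → ℝ) (hγ : ∀ e ∈ G.edgeSet, γ e ∈ Set.Ioo 0 (π / 2))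
    (u : S → ℝ) (hu : u ∈ Set.range (Kuramoto.windingVector S)) :
    ((∀ Γ₁ Γ₂ : Set (Kuramoto.Torus V), M.IsSyncLimitCycle Γ₁ → M.IsSyncLimitCycle Γ₂ →
        Γ₁ ⊆ Kuramoto.windingCell S u ∩ Kuramoto.cohesiveSet G γ →
        Γ₂ ⊆ Kuramoto.windingCell S u ∩ Kuramoto.cohesiveSet G γ →
        ∃ c : Real.Angle, Γ₂ = Kuramoto.rotate c '' Γ₁) ∧
      (∀ Γ : Set (Kuramoto.Torus V), M.IsSyncLimitCycle Γ →
        Γ ⊆ Kuramoto.windingCell S u ∩ Kuramoto.cohesiveSet G γ →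
        M.IsAsymptoticallyStable (Kuramoto.rotationOrbit Γ))) ∧
    (∀ θ : ℝ → Kuramoto.Torus V, M.IsTrajectory θ →
      θ 0 ∈ Kuramoto.windingCell S u ∩ Kuramoto.cohesiveSet G γ →
      (∃ Γ : Set (Kuramoto.Torus V), M.IsSyncLimitCycle Γ ∧
        Γ ⊆ Kuramoto.windingCell S u ∩ closure (Kuramoto.cohesiveSet G γ) ∧
        Kuramoto.ConvergesExponentially θ Γ) ∨
      (∃ t, 0 ≤ t ∧ θ t ∉ Kuramoto.cohesiveSet G γ)) := by
  have := hG.nonempty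
  refine ⟨⟨fun Γ₁ Γ₂ h₁ h₂ hs₁ hs₂ => ?_, fun Γ h hs => ?_⟩, fun θ htraj h0 => ?_⟩
  · obtain ⟨φ₁, hf₁, rfl⟩ := h₁.eq_syncOrbit
    obtain ⟨φ₂, hf₂, rfl⟩ := h₂.eq_syncOrbit
    obtain ⟨c, rfl⟩ := M.exists_rotate_eq_of_sync hG hS hγ (hs₁ (M.mem_syncOrbit φ₁))
      (hs₂ (M.mem_syncOrbit φ₂)) hf₁ hf₂
    refine ⟨c, ?_⟩
    rw [Kuramoto.Model.syncOrbit, Kuramoto.Model.syncOrbit, Set.image_image]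
    refine Set.image_congr fun t _ => ?_
    rw [Kuramoto.rotate_rotate, Kuramoto.rotate_rotate, add_comm]
  · obtain ⟨φ, hf, rfl⟩ := h.eq_syncOrbit
    exact M.isAsymptoticallyStable_rotationOrbit hG hγ (hs (M.mem_syncOrbit φ)).2 hf
  · by_cases hθ : ∀ t, 0 ≤ t → θ t ∈ Kuramoto.cohesiveSet G γ
    · obtain rfl : Kuramoto.windingVector S (θ 0) = u := h0.1
      exact Or.inl (M.exists_limitCycle hG hγ S htraj hθ)
    · push Not at hθ
      exact Or.inr hθ
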